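/- Let $\mathbb K=\mathbb R$ or $\mathbb C$, let $d\ge 0$ be an integer, let $\mathscr D(\mathbb R^d)$ be the space of $\mathbb K$-valued test functions, $\mathscr D'(\mathbb R^d)$ its strong dual, and $L(\mathscr D'(\mathbb R^d))$ the space of continuous $\mathbb K$-linear maps of $\mathscr D'(\mathbb R^d)$ into itself. Put $\mathbb R_*=\mathbb R\setminus\{0\}$ and $\mathbf 1=(1,\dots,1)$; products $xy$ and quotients $x/a$ of vectors are taken coordinatewise, and $T_x$ means that $T$ acts in the variable $x$. For $a\in\mathbb R_*^d$ the dilation $D_a\in L(\mathscr D'(\mathbb R^d))$ is $$(D_aT)\varphi=T_x\Big(\frac{\sigma(a)}{a_1\cdots a_d}\,\varphi\Big(\frac xa\Big)\Big),\qquad \sigma(a)=\prod_{j}\frac{a_j}{|a_j|}.$$ Let $\mathscr D'_H(\mathbb R^d)$ be the set of all $T\in\mathscr D'(\mathbb R^d)$ such that for every $\varphi\in\mathscr D(\mathbb R^d)$ the function $y\mapsto T_x\varphi(xy)$, $y\in\mathbb R_*^d$, is the restriction of a (necessarily unique) function $M_T\varphi\in\mathscr D(\mathbb R^d)$. For $S\in\mathscr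 D'(\mathbb R^d)$ and $T\in\mathscr D'_H(\mathbb R^d)$ let $S\star T$ be the linear form on $\mathscr D(\mathbb R^d)$ given by $(S\star T)\varphi=S(M_T\varphi)=S_y(T_x\varphi(xy))$. Let $L\in L(\mathscr D'(\mathbb R^d))$. 1. $L\circ D_a=D_a\circ L$ for all $a\in\mathbb R_*^d$ if and only if there is $T\in\mathscr D'_H(\mathbb R^d)$ such that $L(S)=S\star T$ for all $S\in\mathscr D'(\mathbb R^d)$. 2. If $T\in\mathscr D'_H(\mathbb R^d)$ and $L(S)=S\star T$ for all $S\in\mathscr D'(\mathbb R^d)$, then $T=L(\delta_{\mathbf 1})$. 3. If $L$ is a Hadamard operator, that is, if for every $\alpha\in\mathbb N_0^d$ there is $m_\alpha\in\mathbb K$ with $L(x^\alpha)=m_\alpha x^\alpha$, then $L$ commutes with all dilations $D_a$, $a\in\mathbb R_*^d$, and there is $T\in\mathscr D'_H(\mathbb R^d)$ such that $L(S)=S\star T$ for all $S\in\mathscr D'(\mathbb R^d)$. -/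

import Mathlib

open scoped Distributions CompactConvergenceCLM

namespace HadamardOperators

open TopologicalSpace MeasureTheory

/-- The space `𝓓(ℝᵈ)` of `𝕜`-valued smooth compactly supported functions on `ℝᵈ`, with its canonical
LF topology. -/
abbrev TestFun (𝕜 : Type*) [RCLike 𝕜] (d : ℕ) : Type _ :=
  𝓓((⊤ : Opens (Fin d → ℝ)), 𝕜)

/-- The space `𝓓'(ℝᵈ)` of distributions: the continuous `𝕜`-linear forms on `𝓓(ℝᵈ)`. As for
Mathlib's `Distribution`, it carries the topology of uniform convergence on compact subsets of
`𝓓(ℝᵈ)`, which is the strong topology because `𝓓(ℝᵈ)` is a Montel space. -/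
abbrev Dist (𝕜 : Type*) [RCLike 𝕜] (d : ℕ) : Type _ :=
  TestFun 𝕜 d →L_c[𝕜] 𝕜

variable {𝕜 : Type*} [RCLike 𝕜] {d : ℕ}

/-- The point `y ∈ ℝ_*ᵈ = (ℝ \ {0})ᵈ`, as a point of `ℝᵈ`. -/
def toPoint (y : Fin d → ℝˣ) : Fin d → ℝ := fun j => (y j : ℝ)

/-- The linear automorphism `x ↦ x y = (x₁ y₁, …, x_d y_d)` of `ℝᵈ`, for `y ∈ ℝ_*ᵈ`. -/
noncomputable def mulEquiv (y : Fin d → ℝˣ) : (Fin d → ℝ) ≃L[ℝ] (Fin d → ℝ) :=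
  ContinuousLinearEquiv.piCongrRight fun j => ContinuousLinearEquiv.unitsEquivAut ℝ (y j)

theorem mulEquiv_apply (y : Fin d → ℝˣ) (x : Fin d → ℝ) : mulEquiv y x = x * toPoint y := by
  ext j
  simp [mulEquiv, toPoint]

/-- For a test function `φ` and `y ∈ ℝ_*ᵈ`, the test function `x ↦ φ (x y)`. -/
noncomputable def scale (y : Fin d → ℝˣ) (φ : TestFun 𝕜 d) : TestFun 𝕜 d where
  toFun x := φ (x * toPoint y)
  contDiff' := by
    have h := φ.contDiff.comp (mulEquiv y).contDiff
    simpa only [Function.comp_def, mulEquiv_apply] using h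
  hasCompactSupport' := by
    have h := φ.hasCompactSupport.comp_homeomorph (mulEquiv y).toHomeomorph
    have e : (φ : (Fin d → ℝ) → 𝕜) ∘ (mulEquiv y).toHomeomorph
        = fun x => φ (x * toPoint y) := by
      funext x
      exact congrArg φ (mulEquiv_apply y x)
    rwa [e] at h
  tsupport_subset' := fun _ _ => trivial

@[simp]
theorem scale_apply (y : Fin d → ℝˣ) (φ : TestFun 𝕜 d) (x : Fin d → ℝ) :
    scale y φ x = φ (x * toPoint y) := rfl

/-- The map `φ ↦ φ (· y)` as a continuous linear operator on `𝓓(ℝᵈ)`, for `y ∈ ℝ_*ᵈ`. -/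
noncomputable def scaleCLM (y : Fin d → ℝˣ) : TestFun 𝕜 d →L[𝕜] TestFun 𝕜 d :=
  TestFunction.limitCLM 𝕜 (scale y)
    (fun K _ =>
      TestFunction.ofSupportedInCLM 𝕜 (Ω := ⊤)
          (K := K.map (mulEquiv y).symm (mulEquiv y).symm.continuous) (fun _ _ => trivial) ∘L
        ContDiffMapSupportedIn.mkCLM 𝕜 (fun f x => f (mulEquiv y x))
          (fun _ _ _ => rfl) (fun _ _ _ => rfl)
          (fun f => f.contDiff.comp (mulEquiv y).contDiff)
          (fun f x hx => f.zero_on_compl fun hK => hx ⟨mulEquiv y x, hK, by simp⟩)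
          (fun i hi => by
            refine ⟨{i}, ‖((mulEquiv y : (Fin d → ℝ) ≃L[ℝ] (Fin d → ℝ)) :
              (Fin d → ℝ) →L[ℝ] (Fin d → ℝ))‖ ^ i, by positivity, fun f x _ => ?_⟩
            have h := ContinuousLinearMap.iteratedFDeriv_comp_right
              ((mulEquiv y : (Fin d → ℝ) ≃L[ℝ] (Fin d → ℝ)) :
                (Fin d → ℝ) →L[ℝ] (Fin d → ℝ)) f.contDiff x (i := i) (by exact_mod_cast hi)
            have h' : iteratedFDeriv ℝ i (fun x => f (mulEquiv y x)) x = _ := h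
            rw [h', Finset.sup_singleton]
            refine (ContinuousMultilinearMap.norm_compContinuousLinearMap_le _ _).trans ?_
            rw [Finset.prod_const, Finset.card_univ, Fintype.card_fin, mul_comm]
            gcongr
            exact ContDiffMapSupportedIn.norm_iteratedFDeriv_apply_le_seminorm 𝕜 hi))
    (fun K _ f => by
      ext x
      exact congrArg f (mulEquiv_apply y x).symm)

@[simp]
theorem scaleCLM_apply (y : Fin d → ℝˣ) (φ : TestFun 𝕜 d) : scaleCLM y φ = scale y φ := rfl

/-- The sign `σ(a) = ∏ⱼ aⱼ / |aⱼ|` of `a ∈ ℝ_*ᵈ`. -/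
noncomputable def sigma (a : Fin d → ℝˣ) : ℝ := ∏ j, (a j : ℝ) / |(a j : ℝ)|

/-- The dilation `D_a ∈ L(𝓓'(ℝᵈ))`, `(D_a T) φ = T_x (σ(a) / (a₁ ⋯ a_d) φ(x / a))`. -/
noncomputable def dilation (a : Fin d → ℝˣ) : Dist 𝕜 d →L[𝕜] Dist 𝕜 d :=
  ((sigma a / ∏ j, (a j : ℝ) : ℝ) : 𝕜) •
    ContinuousLinearMap.precompCompactConvergenceCLM 𝕜 (scaleCLM (𝕜 := 𝕜) a⁻¹)

theorem dilation_apply (a : Fin d → ℝˣ) (T : Dist 𝕜 d) (φ : TestFun 𝕜 d) :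
    dilation a T φ = T (((sigma a / ∏ j, (a j : ℝ) : ℝ) : 𝕜) • scale a⁻¹ φ) :=
  (map_smul (T : TestFun 𝕜 d →L[𝕜] 𝕜) _ _).symm

/-- `L` commutes with dilations: `L ∘ D_a = D_a ∘ L` for all `a ∈ ℝ_*ᵈ`. -/
def CommutesWithDilations (L : Dist 𝕜 d →L[𝕜] Dist 𝕜 d) : Prop :=
  ∀ a : Fin d → ℝˣ, L ∘L dilation a = dilation a ∘L L

/-- The Dirac distribution `δ_x`. -/
noncomputable def diracDelta (x : Fin d → ℝ) : Dist 𝕜 d where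
  toFun φ := φ x
  map_add' _ _ := rfl
  map_smul' _ _ := rfl
  cont := continuous_eval_const _

/-- The monomial `x ↦ x ^ α`, as a distribution. -/
noncomputable def monomial (α : Fin d → ℕ) : Dist 𝕜 d :=
  TestFunction.integralAgainstBilinCLM (ContinuousLinearMap.mul 𝕜 𝕜) volume
    fun x : Fin d → ℝ => ((∏ j, x j ^ α j : ℝ) : 𝕜)

theorem monomial_apply (α : Fin d → ℕ) (φ : TestFun 𝕜 d) :
    monomial α φ = ∫ x : Fin d → ℝ, φ x * ((∏ j, x j ^ α j : ℝ) : 𝕜) := by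
  have h : Continuous fun x : Fin d → ℝ => ((∏ j, x j ^ α j : ℝ) : 𝕜) := by fun_prop
  exact TestFunction.integralAgainstBilinCLM_eq_integral
    (h.locallyIntegrable.locallyIntegrableOn _)

/-- A Hadamard operator is an `L ∈ L(𝓓'(ℝᵈ))` which admits all monomials as eigenvectors. -/
def IsHadamard (L : Dist 𝕜 d →L[𝕜] Dist 𝕜 d) : Prop :=
  ∀ α : Fin d → ℕ, ∃ m : 𝕜, L (monomial α) = m • monomial α

variable (𝕜 d) in
/-- The class `𝓓'_H(ℝᵈ)` of the distributions `T` such that, for every test function `φ`, the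
function `y ↦ T_x φ(x y)` on `ℝ_*ᵈ` is the restriction of a test function on `ℝᵈ`. -/
def DH : Set (Dist 𝕜 d) :=
  {T | ∀ φ : TestFun 𝕜 d, ∃ ψ : TestFun 𝕜 d, ∀ y : Fin d → ℝˣ, ψ (toPoint y) = T (scale y φ)}

/-- The set `ℝ_*ᵈ` is dense in `ℝᵈ`. -/
theorem denseRange_toPoint : DenseRange (toPoint : (Fin d → ℝˣ) → Fin d → ℝ) := by
  have h : DenseRange fun u : ℝˣ => (u : ℝ) := by
    have e : Set.range (fun u : ℝˣ => (u : ℝ)) = {0}ᶜ := by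
      ext x
      exact ⟨by rintro ⟨u, rfl⟩; exact u.ne_zero, fun hx => ⟨Units.mk0 x hx, rfl⟩⟩
    rw [DenseRange, e]
    exact dense_compl_singleton 0
  exact DenseRange.piMap fun _ => h

/-- A test function is determined by its values on `ℝ_*ᵈ`, so the extension in the definition of
`DH` is unique. -/
theorem eq_of_eq_on_toPoint {ψ₁ ψ₂ : TestFun 𝕜 d}
    (h : ∀ y : Fin d → ℝˣ, ψ₁ (toPoint y) = ψ₂ (toPoint y)) : ψ₁ = ψ₂ :=
  DFunLike.coe_injective <|
    denseRange_toPoint.equalizer ψ₁.continuous ψ₂.continuous (funext h)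

/-- For `T ∈ 𝓓'_H(ℝᵈ)`, the operator `M_T` on `𝓓(ℝᵈ)` which sends `φ` to the extension to `ℝᵈ` of
`y ↦ T_x φ(x y)`. -/
noncomputable def opM (T : DH 𝕜 d) : TestFun 𝕜 d →ₗ[𝕜] TestFun 𝕜 d where
  toFun φ := (T.2 φ).choose
  map_add' φ ψ := by
    refine eq_of_eq_on_toPoint fun y => ?_
    have e : scale y (φ + ψ) = scale y φ + scale y ψ := rfl
    rw [(T.2 (φ + ψ)).choose_spec y, e, map_add]
    exact (congrArg₂ (· + ·) ((T.2 φ).choose_spec y) ((T.2 ψ).choose_spec y)).symm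
  map_smul' c φ := by
    refine eq_of_eq_on_toPoint fun y => ?_
    have e : scale y (c • φ) = c • scale y φ := rfl
    rw [(T.2 (c • φ)).choose_spec y, e, map_smul]
    exact (congrArg (c • ·) ((T.2 φ).choose_spec y)).symm

theorem opM_toPoint (T : DH 𝕜 d) (φ : TestFun 𝕜 d) (y : Fin d → ℝˣ) :
    opM T φ (toPoint y) = (T : Dist 𝕜 d) (scale y φ) :=
  (T.2 φ).choose_spec y

/-- The `⋆`-convolution `S ⋆ T` of `S ∈ 𝓓'(ℝᵈ)` and `T ∈ 𝓓'_H(ℝᵈ)`, as a linear form on `𝓓(ℝᵈ)`: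
`(S ⋆ T) φ = S_y (T_x φ(x y))`. -/
noncomputable def starConv (S : Dist 𝕜 d) (T : DH 𝕜 d) : TestFun 𝕜 d →ₗ[𝕜] 𝕜 :=
  (S : TestFun 𝕜 d →L[𝕜] 𝕜).toLinearMap ∘ₗ opM T

theorem starConv_apply (S : Dist 𝕜 d) (T : DH 𝕜 d) (φ : TestFun 𝕜 d) :
    starConv S T φ = S (opM T φ) := rfl

/-- `L = L_T`, that is, `L S = S ⋆ T` for all `S ∈ 𝓓'(ℝᵈ)`. -/
def IsStarConvBy (L : Dist 𝕜 d →L[𝕜] Dist 𝕜 d) (T : DH 𝕜 d) : Prop :=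
  ∀ (S : Dist 𝕜 d) (φ : TestFun 𝕜 d), L S φ = starConv S T φ

end HadamardOperators

/-! The space of test functions is reflexive, so every `L` is the transpose of a map `M` of test
functions: `L S φ = S (M φ)` (`exists_transpose`). Up to a nonzero scalar, `δ_y` with `y ∈ ℝ_*ᵈ` is
a dilate of `δ_𝟏`. If `L` commutes with dilations, then `M φ` at `y` is therefore `T = L δ_𝟏`
applied to `x ↦ φ (x y)`; hence `T` lies in `DH` and `M = opM T`. Conversely, `opM T` commutes with
scalings.

For a Hadamard operator, `L` and `D_a` are both diagonal on monomials, so their commutator kills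
every monomial. Its transpose then takes values orthogonal to all polynomials, and these values
vanish by Stone–Weierstrass, having compact support.

Reflexivity: a continuous form on distributions is controlled by a compact set `Q` of test
functions. `Q` lies in a single Fréchet space `𝓓_K`, whose completeness makes the closed convex hull
of a scaled, balanced copy of `Q` compact. Hahn–Banach finds the representing test function in this
hull. -/

/-- A linear form `ℓ` on a space `W` in duality with `E` which is dominated by the support function
of a compact convex subset `C` of `E` is represented by a point of `C`. -/
theorem exists_mem_forall_eq_of_re_le {𝕜 W E : Type*} [RCLike 𝕜] [AddCommGroup W] [Module 𝕜 W]
    [AddCommGroup E] [Module 𝕜 E] [Module ℝ E] [IsScalarTower ℝ 𝕜 E] [TopologicalSpace E]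
    (B : W →ₗ[𝕜] E →ₗ[𝕜] 𝕜) (hB : ∀ w, Continuous (B w)) {C : Set E} (hC : IsCompact C)
    (hconv : Convex ℝ C) (ℓ : W →ₗ[𝕜] 𝕜)
    (hℓ : ∀ (w : W) (u : ℝ), (∀ x ∈ C, RCLike.re (B w x) < u) → RCLike.re (ℓ w) ≤ u) :
    ∃ x ∈ C, ∀ w, B w x = ℓ w := by
  suffices h : (C ∩ ⋂ w, {x | B w x = ℓ w}).Nonempty by
    obtain ⟨x, hx, hx'⟩ := h
    exact ⟨x, hx, fun w => Set.mem_iInter.1 hx' w⟩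
  -- By compactness finitely many `w` suffice, so the separation takes place in the
  -- finite-dimensional space `s → 𝕜`.
  refine hC.inter_iInter_nonempty _ (fun w => isClosed_eq (hB w) continuous_const) fun s => ?_
  let Φ : E →ₗ[𝕜] (s → 𝕜) := LinearMap.pi fun w => B w
  have hΦ : Continuous Φ := continuous_pi fun w => hB w
  suffices h : (fun w : s => ℓ w) ∈ Φ '' C by
    obtain ⟨x, hx, hx'⟩ := h
    refine ⟨x, hx, Set.mem_iInter₂.2 fun w hw => ?_⟩
    exact congrFun hx' ⟨w, hw⟩
  classical
  by_contra hmem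
  obtain ⟨f, u, hu, hu'⟩ := RCLike.geometric_hahn_banach_closed_point (𝕜 := 𝕜)
    (hconv.linear_image (Φ.restrictScalars ℝ)) (hC.image hΦ).isClosed hmem
  have hf (z : s → 𝕜) : f z = ∑ w, z w * f (Pi.single w 1) := by
    conv_lhs => rw [pi_eq_sum_univ' z]
    simp [map_sum]
  -- The separating functional on `s → 𝕜` is pairing with this one element of `W`, to which `hℓ`
  -- applies.
  let w₀ : W := ∑ w : s, f (Pi.single w 1) • (w : W)
  have h₁ : f (fun w : s => ℓ w) = ℓ w₀ := by
    rw [hf]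
    simp [w₀, map_sum, mul_comm]
  have h₂ (x : E) : f (Φ x) = B w₀ x := by
    rw [hf]
    simp [w₀, Φ, map_sum, mul_comm]
  rw [h₁] at hu'
  exact absurd (hℓ w₀ u fun x hx => h₂ x ▸ hu _ ⟨x, hx, rfl⟩) (not_le.2 hu')

/-! ### Completeness of `𝓓_K` -/

section Complete

open Filter Topology

variable {E F : Type*} [NormedAddCommGroup E] [NormedSpace ℝ E] [NormedAddCommGroup F]
  [NormedSpace ℝ F] {K : TopologicalSpace.Compacts E}

/-- The Fréchet space `𝓓_K(E, F)` is complete. -/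
theorem ContDiffMapSupportedIn.completeSpace [CompleteSpace F] : CompleteSpace 𝓓_{K}(E, F) := by
  have hemb := isUniformEmbedding_pi_structureMapCLM (𝕜 := ℝ) (n := ⊤) (E := E) (F := F) (K := K)
  have : IsCountablyGenerated (uniformity 𝓓_{K}(E, F)) := by
    rw [← hemb.comap_uniformity]
    infer_instance
  refine UniformSpace.complete_of_cauchySeq_tendsto fun u hu => ?_
  have hu' := hu.map hemb.uniformContinuous
  obtain ⟨g, hg⟩ := cauchySeq_tendsto_of_complete hu'
  have hgi (i : ℕ) : TendstoUniformly (fun n x => iteratedFDeriv ℝ i (u n) x) (g i) atTop := by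
    have := BoundedContinuousFunction.tendsto_iff_tendstoUniformly.1 (tendsto_pi_nhds.1 hg i)
    have e : (fun n x => iteratedFDeriv ℝ i (u n) x) =
        fun n => ⇑(structureMapCLM ℝ ⊤ i (u n)) :=
      funext fun n => (structureMapCLM_top_apply ℝ (u n)).symm
    rwa [e]
  -- The limit of the derivatives of order `0`; uniform convergence in each order makes the `g i`
  -- its Taylor series.
  let f : E → F := fun x => (g 0 x) 0
  have htaylor : HasFTaylorSeriesUpTo (⊤ : ℕ∞) f fun x i => g i x := by
    refine ⟨fun x => rfl, fun i _ x => ?_, fun i _ => (g i).continuous⟩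
    refine hasFDerivAt_of_tendstoUniformly (l := atTop)
      (f := fun n x => iteratedFDeriv ℝ i (u n) x)
      (f' := fun n x => (iteratedFDeriv ℝ (i + 1) (u n) x).curryLeft)
      (g' := fun x => (g (i + 1) x).curryLeft) ?_ (fun n x => ?_)
      (fun x => (hgi i).tendsto_at x) x
    · exact (continuousMultilinearCurryLeftEquiv ℝ (fun _ : Fin (i + 1) => E) F).isometry
        |>.uniformContinuous.comp_tendstoUniformly (hgi (i + 1))
    · have := (u n).contDiff.ftaylorSeries.fderiv i (by exact_mod_cast ENat.natCast_lt_top i) x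
      exact this
  have hsupp : Function.support f ⊆ K := by
    intro x hx
    by_contra hxK
    refine hx (tendsto_nhds_unique
      (((hgi 0).tendsto_at x).eval_const (0 : Fin 0 → E)) ?_)
    simp [(u _).zero_on_compl hxK]
  let ψ : 𝓓_{K}(E, F) := .of_support_subset htaylor.contDiff hsupp
  refine ⟨ψ, hemb.isInducing.tendsto_nhds_iff.2 ?_⟩
  have e : ContinuousLinearMap.pi (structureMapCLM ℝ ⊤) ψ = g := by
    funext i
    ext x : 1
    exact (congrFun (structureMapCLM_top_apply ℝ ψ) x).trans
      (htaylor.eq_iteratedFDeriv (by exact_mod_cast le_top) x).symm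
  rw [e]
  exact hg

end Complete

/-! ### The topology that `𝓓_K` inherits from the space of test functions -/

section Inducing

variable {E F : Type*} [NormedAddCommGroup E] [NormedSpace ℝ E] [NormedAddCommGroup F]
  [NormedSpace ℝ F] {K : TopologicalSpace.Compacts E} {Ω : TopologicalSpace.Opens E}

theorem BoundedContinuousFunction.locallyConvex {α β : Type*} [TopologicalSpace α]
    [SeminormedAddCommGroup β] [NormedSpace ℝ β] :
    IsTopologicalAddGroup (BoundedContinuousFunction α β) ∧
      LocallyConvexSpace ℝ (BoundedContinuousFunction α β) :=
  ⟨inferInstance, inferInstance⟩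

instance (i : ℕ) : IsTopologicalAddGroup
    (BoundedContinuousFunction E (ContinuousMultilinearMap ℝ (fun _ : Fin i => E) F)) :=
  BoundedContinuousFunction.locallyConvex.1

instance (i : ℕ) : LocallyConvexSpace ℝ
    (BoundedContinuousFunction E (ContinuousMultilinearMap ℝ (fun _ : Fin i => E) F)) :=
  BoundedContinuousFunction.locallyConvex.2

/-- The `i`-th derivative, as a continuous linear map on the space of test functions. -/
noncomputable def TestFunction.iteratedFDerivBCF (i : ℕ) :
    𝓓(Ω, F) →L[ℝ] BoundedContinuousFunction E (ContinuousMultilinearMap ℝ (fun _ : Fin i => E) F) :=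
  TestFunction.limitCLM ℝ
    (fun φ => ContDiffMapSupportedIn.structureMapCLM ℝ ⊤ i
      (ContDiffMapSupportedIn.of_support_subset φ.contDiff subset_closure :
        𝓓_{⟨tsupport φ, φ.hasCompactSupport⟩}(E, F)))
    (fun _ _ => ContDiffMapSupportedIn.structureMapCLM ℝ ⊤ i)
    (fun K hK f => by
      ext x : 1
      exact (congrFun (ContDiffMapSupportedIn.structureMapCLM_top_apply ℝ _) x).trans
        (congrFun (ContDiffMapSupportedIn.structureMapCLM_top_apply ℝ f) x).symm)

/-- The inclusion of `𝓓_K(E, F)` into the space of test functions is a topological embedding. -/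
theorem TestFunction.isInducing_ofSupportedIn (hK : (K : Set E) ⊆ Ω) :
    Topology.IsInducing (ofSupportedIn hK : 𝓓_{K}(E, F) → 𝓓(Ω, F)) := by
  have h := (ContDiffMapSupportedIn.isUniformEmbedding_pi_structureMapCLM (𝕜 := ℝ) (n := ⊤)
    (E := E) (F := F) (K := K)).isInducing
  -- The derivative maps embed `𝓓_K` and extend continuously to all test functions, so `𝓓_K` cannot
  -- have a finer topology than the induced one.
  refine Topology.IsInducing.of_comp (continuous_ofSupportedIn hK)
    (ContinuousLinearMap.pi fun i => iteratedFDerivBCF i).continuous ?_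
  have e : (ContinuousLinearMap.pi fun i => iteratedFDerivBCF i : 𝓓(Ω, F) →L[ℝ] _) ∘
      (ofSupportedIn hK : 𝓓_{K}(E, F) → 𝓓(Ω, F)) =
      ContinuousLinearMap.pi (ContDiffMapSupportedIn.structureMapCLM ℝ ⊤) := by
    funext f i
    ext x : 1
    exact (congrFun (ContDiffMapSupportedIn.structureMapCLM_top_apply ℝ _) x).trans
      (congrFun (ContDiffMapSupportedIn.structureMapCLM_top_apply ℝ f) x).symm
  rw [e]
  exact h

end Inducing

/-! ### Common support of a compact set of test functions -/

section Support

variable {E F : Type*} [NormedAddCommGroup E] [NormedSpace ℝ E] [NormedAddCommGroup F]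
  [NormedSpace ℝ F] {Ω : TopologicalSpace.Opens E}

/-- For a sequence `x` tending to infinity, the weighted evaluation `φ ↦ (c n • φ (x n))ₙ` is a
continuous linear map from the space of test functions to the bounded sequences. -/
theorem TestFunction.exists_weightedEval {x : ℕ → E} (hx : ∀ n : ℕ, (n : ℝ) < ‖x n‖) (c : ℕ → ℝ) :
    ∃ T : 𝓓(Ω, F) →L[ℝ] BoundedContinuousFunction ℕ F, ∀ φ n, T φ n = c n • φ (x n) := by
  have key (K : TopologicalSpace.Compacts E) : ∃ A : ℝ, 0 ≤ A ∧ ∀ f : 𝓓_{K}(E, F), ∀ n,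
      ‖c n • f (x n)‖ ≤ A * N[ℝ]_{K, 0} f := by
    obtain ⟨R, hR⟩ := K.isCompact.isBounded.exists_norm_le
    obtain ⟨N, hN⟩ := exists_nat_ge R
    -- For `n ≥ N` the point `x n` lies outside `K`, so only the first `N` weights matter.
    refine ⟨∑ i ∈ Finset.range N, ‖c i‖, by positivity, fun f n => ?_⟩
    by_cases hn : n < N
    · rw [norm_smul]
      gcongr
      · exact Finset.single_le_sum (f := fun i => ‖c i‖) (fun i _ => norm_nonneg _)
          (Finset.mem_range.2 hn)
      · exact ContDiffMapSupportedIn.norm_apply_le_seminorm ℝ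
    · have : x n ∉ (K : Set E) := fun h => by
        have h₁ := hR _ h
        have h₂ := hx n
        have h₃ : (N : ℝ) ≤ n := by exact_mod_cast not_lt.1 hn
        linarith
      rw [f.zero_on_compl this]
      simp only [Pi.zero_apply, smul_zero, norm_zero]
      positivity
  have bdd (φ : 𝓓(Ω, F)) : ∃ A : ℝ, ∀ n, ‖c n • φ (x n)‖ ≤ A := by
    obtain ⟨A, -, hA⟩ := key ⟨tsupport φ, φ.hasCompactSupport⟩
    exact ⟨_, hA (.of_support_subset φ.contDiff subset_closure)⟩
  choose M hM using bdd
  let toFun (φ : 𝓓(Ω, F)) : BoundedContinuousFunction ℕ F :=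
    .ofNormedAddCommGroupDiscrete (fun n => c n • φ (x n)) (M φ) (hM φ)
  refine ⟨TestFunction.mkCLM ℝ toFun (fun φ ψ => ?_) (fun a φ => ?_) fun K hK => ?_,
    fun φ n => rfl⟩
  · ext n
    exact smul_add _ _ _
  · ext n
    exact smul_comm _ _ _
  · obtain ⟨A, hA, hA'⟩ := key K
    refine (ContDiffMapSupportedIn.mkCLMtoNormedSpace (𝕜 := ℝ)
      (fun f : 𝓓_{K}(E, F) => toFun (ofSupportedIn hK f)) (fun f g => ?_) (fun a f => ?_)
      ⟨{0}, A, hA, fun f => ?_⟩).continuous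
    · ext n
      exact smul_add _ _ _
    · ext n
      exact smul_comm _ _ _
    · rw [Finset.sup_singleton]
      exact (BoundedContinuousFunction.norm_le (by positivity)).2 (hA' f)

/-- The functions in a compact set of test functions are supported in a common ball. -/
theorem TestFunction.exists_forall_eq_zero_of_isCompact {S : Set 𝓓(Ω, F)} (hS : IsCompact S) :
    ∃ R : ℝ, ∀ φ ∈ S, ∀ x, R < ‖x‖ → φ x = 0 := by
  by_contra! h
  choose φ hφ x hx hne using fun n : ℕ => h n
  -- With these weights the `n`-th entry of `T (φ n)` has norm `n`, so the image of `S` is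
  -- unbounded.
  obtain ⟨T, hT⟩ := TestFunction.exists_weightedEval (F := F) (Ω := Ω) hx fun n => n / ‖φ n (x n)‖
  obtain ⟨M, hM⟩ := (hS.image T.continuous).isBounded.exists_norm_le
  obtain ⟨n, hn⟩ := exists_nat_gt M
  have h₁ := ((T (φ n)).norm_coe_le_norm n).trans (hM _ ⟨_, hφ n, rfl⟩)
  rw [hT, norm_smul, norm_div, norm_norm, div_mul_cancel₀ _ (norm_ne_zero_iff.2 (hne n)),
    RCLike.norm_natCast] at h₁
  exact absurd hn (not_lt.2 h₁)

end Support

/-! ### Reflexivity and transposes -/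

namespace HadamardOperators

open TopologicalSpace MeasureTheory

variable {𝕜 : Type*} [RCLike 𝕜] {d : ℕ}

/-- `𝓓(ℝᵈ)` is reflexive: every continuous linear form on `𝓓'(ℝᵈ)` is the evaluation at a test
function. -/
theorem exists_testFun_forall_eq (ℓ : Dist 𝕜 d →L[𝕜] 𝕜) :
    ∃ ψ : TestFun 𝕜 d, ∀ S : Dist 𝕜 d, ℓ S = S ψ := by
  have hnhds : {S : Dist 𝕜 d | ‖ℓ S‖ < 1} ∈ nhds 0 :=
    (isOpen_lt ℓ.continuous.norm continuous_const).mem_nhds (by simp)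
  obtain ⟨⟨Q, ε⟩, ⟨hQ, hε⟩, hQε⟩ :=
    (CompactConvergenceCLM.hasBasis_nhds_zero_of_basis Metric.nhds_basis_ball).mem_iff.1 hnhds
  replace hε : 0 < ε := hε
  obtain ⟨R, hR⟩ := TestFunction.exists_forall_eq_zero_of_isCompact hQ
  let K : Compacts (Fin d → ℝ) := ⟨Metric.closedBall 0 R, isCompact_closedBall 0 R⟩
  let ι : 𝓓_{K}(Fin d → ℝ, 𝕜) →L[𝕜] TestFun 𝕜 d :=
    TestFunction.ofSupportedInCLM 𝕜 (Ω := ⊤) fun _ _ => trivial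
  have hrange : Q ⊆ Set.range ι := fun φ hφ =>
    ⟨.of_support_subset φ.contDiff fun x hx => by
      by_contra h
      exact hx (hR φ hφ x (not_le.1 fun h' => h (by simpa [K] using h'))), rfl⟩
  have hQ₀ : IsCompact (ι ⁻¹' Q) :=
    (Topology.IsInducing.isCompact_preimage_iff (f := ι)
      (TestFunction.isInducing_ofSupportedIn (Ω := ⊤) fun _ _ => trivial) hrange).2 hQ
  -- The scalars make `Z` balanced, so that a bound on real parts bounds moduli; the radius `ε⁻¹`
  -- matches the neighbourhood given by `Q` and `ε`. Inserting `0` keeps `Z` nonempty and forces `0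
  -- < u` below.
  let Z : Set 𝓓_{K}(Fin d → ℝ, 𝕜) :=
    (fun p : 𝕜 × 𝓓_{K}(Fin d → ℝ, 𝕜) => p.1 • p.2) ''
      (Metric.closedBall 0 ε⁻¹ ×ˢ insert 0 (ι ⁻¹' Q))
  have hZ : IsCompact Z :=
    ((isCompact_closedBall _ _).prod (hQ₀.insert 0)).image continuous_smul
  have : CompleteSpace 𝓓_{K}(Fin d → ℝ, 𝕜) := ContDiffMapSupportedIn.completeSpace
  have hC : IsCompact (closure (convexHull ℝ Z)) :=
    isCompact_closure_of_totallyBounded_quasiComplete (𝕜 := ℝ) hZ.totallyBounded.convexHull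
  have hsub : Z ⊆ closure (convexHull ℝ Z) := (subset_convexHull ℝ Z).trans subset_closure
  let B : Dist 𝕜 d →ₗ[𝕜] 𝓓_{K}(Fin d → ℝ, 𝕜) →ₗ[𝕜] 𝕜 :=
    LinearMap.mk₂ 𝕜 (fun S f => S (ι f)) (fun _ _ _ => rfl) (fun _ _ _ => rfl)
      (fun S f g => by rw [map_add, map_add]) (fun a S f => by rw [map_smul, map_smul])
  have hℓ (S : Dist 𝕜 d) (u : ℝ) (hu : ∀ f ∈ closure (convexHull ℝ Z), RCLike.re (B S f) < u) :
      RCLike.re (ℓ S) ≤ u := by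
    have hu₀ : 0 < u := by
      have := hu 0 (hsub ⟨(0, 0), ⟨by simp [hε.le], by simp⟩, by simp⟩)
      simpa using this
    have hSQ : ∀ φ ∈ Q, ‖S φ‖ < u * ε := fun φ hφ => by
      obtain ⟨g, rfl⟩ := hrange hφ
      obtain ⟨c, hc, hc'⟩ := RCLike.exists_norm_eq_mul_self (S (ι g))
      have h := hu (((ε⁻¹ : ℝ) : 𝕜) • c • g) (hsub ⟨(((ε⁻¹ : ℝ) : 𝕜) * c, g), ⟨?_, ?_⟩, ?_⟩)
      · have e : B S (((ε⁻¹ : ℝ) : 𝕜) • c • g) = ((ε⁻¹ * ‖S (ι g)‖ : ℝ) : 𝕜) := by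
          rw [map_smul, map_smul, smul_eq_mul, smul_eq_mul, RCLike.ofReal_mul, hc']
          rfl
        rw [e, RCLike.ofReal_re, inv_mul_lt_iff₀ hε] at h
        rwa [mul_comm]
      · simp [hc, abs_of_pos hε]
      · exact Set.mem_insert_of_mem _ hφ
      · exact mul_smul _ _ _
    -- Since `‖S φ‖ < u * ε` on `Q`, the multiple `u⁻¹ • S` lies in the neighbourhood where `‖ℓ ·‖ <
    -- 1`.
    have h := hQε (show ((u⁻¹ : ℝ) : 𝕜) • S ∈ _ from fun φ hφ => ?_)
    · have h' : ‖ℓ (((u⁻¹ : ℝ) : 𝕜) • S)‖ < 1 := h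
      rw [map_smul, norm_smul, RCLike.norm_ofReal, abs_of_pos (by positivity),
        inv_mul_lt_iff₀ hu₀, mul_one] at h'
      exact (RCLike.re_le_norm _).trans h'.le
    · rw [mem_ball_zero_iff]
      change ‖((u⁻¹ : ℝ) : 𝕜) • S φ‖ < ε
      rw [norm_smul, RCLike.norm_ofReal, abs_of_pos (by positivity), inv_mul_lt_iff₀ hu₀]
      exact hSQ φ hφ
  obtain ⟨f, -, hf⟩ := exists_mem_forall_eq_of_re_le B
    (fun S => (ContinuousLinearMap.continuous (S : TestFun 𝕜 d →L[𝕜] 𝕜)).comp ι.continuous)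
    hC (convex_convexHull ℝ Z).closure ℓ.toLinearMap hℓ
  exact ⟨ι f, fun S => (hf S).symm⟩

/-- Every operator on `𝓓'(ℝᵈ)` is the transpose of a map of `𝓓(ℝᵈ)` into itself. -/
theorem exists_transpose (L : Dist 𝕜 d →L[𝕜] Dist 𝕜 d) :
    ∃ M : TestFun 𝕜 d → TestFun 𝕜 d, ∀ S φ, L S φ = S (M φ) := by
  have h (φ : TestFun 𝕜 d) : ∃ ψ : TestFun 𝕜 d, ∀ S : Dist 𝕜 d, L S φ = S ψ :=
    exists_testFun_forall_eq
      { toFun := fun S => L S φ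
        map_add' := fun S T => by rw [map_add]; rfl
        map_smul' := fun c S => by rw [map_smul]; rfl
        cont := (continuous_eval_const φ).comp L.continuous }
  choose M hM using h
  exact ⟨M, fun S φ => hM φ S⟩

/-! ### Dilations and the `⋆`-convolution -/

theorem scale_scale (a y : Fin d → ℝˣ) (φ : TestFun 𝕜 d) :
    scale y (scale a φ) = scale (y * a) φ := by
  ext x
  simp only [scale_apply]
  congr 1
  ext j
  simp [toPoint, mul_assoc]

theorem scale_one (φ : TestFun 𝕜 d) : scale 1 φ = φ := by
  ext x
  simp only [scale_apply]
  congr 1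
  ext j
  simp [toPoint]

theorem sigma_div_prod (a : Fin d → ℝˣ) :
    sigma a / ∏ j, (a j : ℝ) = |∏ j, (a j : ℝ)|⁻¹ := by
  rw [sigma, ← Finset.prod_div_distrib, Finset.abs_prod, ← Finset.prod_inv_distrib]
  refine Finset.prod_congr rfl fun j _ => ?_
  have := (a j).ne_zero
  field_simp

theorem sigma_div_prod_ne_zero (a : Fin d → ℝˣ) :
    ((sigma a / ∏ j, (a j : ℝ) : ℝ) : 𝕜) ≠ 0 := by
  rw [sigma_div_prod]
  have : ∏ j, (a j : ℝ) ≠ 0 := Finset.prod_ne_zero_iff.2 fun j _ => (a j).ne_zero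
  exact_mod_cast inv_ne_zero (abs_ne_zero.2 this)

theorem dilation_inv_diracDelta_one (y : Fin d → ℝˣ) :
    dilation y⁻¹ (diracDelta 1 : Dist 𝕜 d) =
      ((sigma y⁻¹ / ∏ j, ((y⁻¹) j : ℝ) : ℝ) : 𝕜) • diracDelta (toPoint y) := by
  ext φ
  rw [dilation_apply, inv_inv]
  change _ * φ (1 * toPoint y) = _ * φ (toPoint y)
  rw [one_mul]

/-- An operator which commutes with dilations is determined by its value at `δ_𝟏`. -/
theorem CommutesWithDilations.apply_diracDelta {L : Dist 𝕜 d →L[𝕜] Dist 𝕜 d}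
    (hL : CommutesWithDilations L) (y : Fin d → ℝˣ) (φ : TestFun 𝕜 d) :
    L (diracDelta (toPoint y)) φ = L (diracDelta 1) (scale y φ) := by
  have h := congrArg (fun S : Dist 𝕜 d => S φ)
    (congrArg (fun A : Dist 𝕜 d →L[𝕜] Dist 𝕜 d => A (diracDelta 1)) (hL y⁻¹))
  simp only [ContinuousLinearMap.comp_apply] at h
  rw [dilation_inv_diracDelta_one, map_smul, dilation_apply, inv_inv, map_smul] at h
  exact mul_left_cancel₀ (sigma_div_prod_ne_zero y⁻¹) h

/-- Testing the transpose on `δ_y` shows that `M φ` itself is the extension required for `L δ_𝟏` to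
lie in `DH`. Continuity of `M` is not needed. -/
theorem CommutesWithDilations.exists_isStarConvBy {L : Dist 𝕜 d →L[𝕜] Dist 𝕜 d}
    (hL : CommutesWithDilations L) : ∃ T : DH 𝕜 d, IsStarConvBy L T := by
  obtain ⟨M, hM⟩ := exists_transpose L
  have hMT (φ : TestFun 𝕜 d) (y : Fin d → ℝˣ) :
      M φ (toPoint y) = L (diracDelta 1) (scale y φ) :=
    (hM (diracDelta (toPoint y)) φ).symm.trans (hL.apply_diracDelta y φ)
  let T : DH 𝕜 d := ⟨L (diracDelta 1), fun φ => ⟨M φ, hMT φ⟩⟩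
  refine ⟨T, fun S φ => ?_⟩
  rw [starConv_apply, hM]
  exact congrArg S (eq_of_eq_on_toPoint fun y => (hMT φ y).trans (opM_toPoint T φ y).symm)

theorem opM_scale (T : DH 𝕜 d) (a : Fin d → ℝˣ) (φ : TestFun 𝕜 d) :
    opM T (scale a φ) = scale a (opM T φ) := by
  refine eq_of_eq_on_toPoint fun y => ?_
  have e : toPoint y * toPoint a = toPoint (y * a) := rfl
  rw [opM_toPoint, scale_scale, scale_apply, e, opM_toPoint]

theorem IsStarConvBy.commutesWithDilations {L : Dist 𝕜 d →L[𝕜] Dist 𝕜 d} {T : DH 𝕜 d}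
    (hL : IsStarConvBy L T) : CommutesWithDilations L := by
  intro a
  ext S φ
  simp only [ContinuousLinearMap.comp_apply]
  rw [hL, starConv_apply, dilation_apply, dilation_apply, hL, starConv_apply, map_smul (opM T),
    opM_scale]

theorem IsStarConvBy.eq_apply_diracDelta {L : Dist 𝕜 d →L[𝕜] Dist 𝕜 d} {T : DH 𝕜 d}
    (hL : IsStarConvBy L T) : (T : Dist 𝕜 d) = L (diracDelta 1) := by
  ext φ
  rw [hL, starConv_apply]
  -- The value of `opM T φ` at `𝟏` is `T φ`.
  exact (congrArg (T : Dist 𝕜 d) (scale_one φ).symm).trans (opM_toPoint T φ 1).symm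

/-! ### Monomials and Hadamard operators -/

/-- The monomials are eigenvectors of the dilations. -/
theorem dilation_monomial (a : Fin d → ℝˣ) (α : Fin d → ℕ) :
    dilation a (monomial α : Dist 𝕜 d) =
      ((∏ j, (a j : ℝ) ^ α j : ℝ) : 𝕜) • (monomial α : Dist 𝕜 d) := by
  ext φ
  have hdet : (Matrix.diagonal (toPoint a)).det = ∏ j, (a j : ℝ) := Matrix.det_diagonal
  have hdet₀ : (Matrix.diagonal (toPoint a)).det ≠ 0 := by
    rw [hdet]
    exact Finset.prod_ne_zero_iff.2 fun j _ => (a j).ne_zero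
  have hlin (x : Fin d → ℝ) : Matrix.toLin' (Matrix.diagonal (toPoint a)) x = toPoint a * x := by
    ext j
    simp [Matrix.mulVec_diagonal]
  rw [dilation_apply, map_smul]
  change _ * monomial α (scale a⁻¹ φ) = _ * monomial α φ
  rw [monomial_apply, monomial_apply]
  -- Substituting `a x` for `x` yields the Jacobian `|∏ a_j|`, which cancels the factor of the
  -- dilation.
  conv_lhs => rw [← Real.smul_map_diagonal_volume_pi hdet₀]
  have hcont : Continuous fun x : Fin d → ℝ =>
      (scale a⁻¹ φ) x * ((∏ j, x j ^ α j : ℝ) : 𝕜) := by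
    have := (scale a⁻¹ φ).continuous
    fun_prop
  rw [integral_smul_measure, integral_map (LinearMap.continuous_of_finiteDimensional _).aemeasurable
    hcont.aestronglyMeasurable, hdet, ENNReal.toReal_ofReal (abs_nonneg _), sigma_div_prod]
  have e (x : Fin d → ℝ) : (scale a⁻¹ φ) (Matrix.toLin' (Matrix.diagonal (toPoint a)) x) *
      ((∏ j, (Matrix.toLin' (Matrix.diagonal (toPoint a)) x) j ^ α j : ℝ) : 𝕜) =
      ((∏ j, (a j : ℝ) ^ α j : ℝ) : 𝕜) * (φ x * ((∏ j, x j ^ α j : ℝ) : 𝕜)) := by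
    have h₁ : toPoint a * x * toPoint a⁻¹ = x := by
      ext j
      simp [toPoint, mul_comm (a j : ℝ)]
    have h₂ : ∏ j, (toPoint a * x) j ^ α j = (∏ j, (a j : ℝ) ^ α j) * ∏ j, x j ^ α j := by
      simp [toPoint, mul_pow, Finset.prod_mul_distrib]
    rw [hlin, scale_apply, h₁, h₂, RCLike.ofReal_mul]
    ring
  simp_rw [e]
  rw [integral_const_mul, RCLike.real_smul_eq_coe_mul, ← mul_assoc, ← RCLike.ofReal_mul,
    inv_mul_cancel₀ (abs_ne_zero.2 (hdet ▸ hdet₀)), RCLike.ofReal_one, one_mul]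

/-- A test function which is orthogonal to all monomials vanishes. -/
theorem eq_zero_of_forall_monomial {ψ : TestFun 𝕜 d} (h : ∀ α, monomial α ψ = 0) : ψ = 0 := by
  have hint (f : (Fin d → ℝ) → ℝ) (hf : Continuous f) :
      Integrable fun x => ψ x * (f x : 𝕜) :=
    (ψ.continuous.mul (RCLike.continuous_ofReal.comp hf)).integrable_of_hasCompactSupport
      ψ.hasCompactSupport.mul_right
  have hpoly (q : MvPolynomial (Fin d) ℝ) :
      ∫ x : Fin d → ℝ, ψ x * ((MvPolynomial.eval x q : ℝ) : 𝕜) = 0 := by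
    induction q using MvPolynomial.induction_on' with
    | monomial α c =>
      have := h α
      rw [monomial_apply] at this
      simp_rw [MvPolynomial.eval_monomial, RCLike.ofReal_mul, mul_left_comm _ (c : 𝕜)]
      simp_rw [Finsupp.prod_fintype α _ fun _ => pow_zero _]
      rw [integral_const_mul, this, mul_zero]
    | add p q hp hq =>
      simp only [map_add, mul_add]
      rw [integral_add (hint _ p.continuous_eval) (hint _ q.continuous_eval), hp, hq, add_zero]
  have hcont (f : (Fin d → ℝ) → ℝ) (hf : Continuous f) : ∫ x, ψ x * (f x : 𝕜) = 0 := by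
    let K := tsupport ψ
    have : CompactSpace K := isCompact_iff_compactSpace.1 ψ.hasCompactSupport
    let Φ : MvPolynomial (Fin d) ℝ →ₐ[ℝ] C(K, ℝ) :=
      MvPolynomial.aeval fun j => ⟨fun x => (x : Fin d → ℝ) j, (continuous_apply j).comp continuous_subtype_val⟩
    have hΦ (q : MvPolynomial (Fin d) ℝ) (x : K) : Φ q x = MvPolynomial.eval x q := by
      induction q using MvPolynomial.induction_on with
      | C a => simp [Φ]
      | add p q hp hq => simp [hp, hq]
      | mul_X p j hp => simp [hp, Φ]
    have hsep : Φ.range.SeparatesPoints := fun x y hxy => by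
      obtain ⟨j, hj⟩ := Function.ne_iff.1 fun e => hxy (Subtype.ext e)
      exact ⟨_, ⟨Φ (MvPolynomial.X j), ⟨_, rfl⟩, rfl⟩, by simpa [hΦ] using hj⟩
    refine norm_le_zero_iff.1 (le_of_forall_pos_le_add fun δ hδ => ?_)
    have hI : 0 ≤ ∫ x, ‖ψ x‖ := integral_nonneg fun _ => norm_nonneg _
    -- The `1 +` keeps the denominator positive, and the total error still stays below `δ`.
    obtain ⟨⟨g, q, rfl⟩, hg⟩ := ContinuousMap.exists_mem_subalgebra_near_continuous_of_separatesPoints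
      Φ.range hsep (fun x : K => f x) (by fun_prop) (δ / (1 + ∫ x, ‖ψ x‖)) (by positivity)
    rw [← sub_zero (∫ x, ψ x * (f x : 𝕜)), ← hpoly q,
      ← integral_sub (hint f hf) (hint _ q.continuous_eval), zero_add]
    calc _ ≤ ∫ x, ‖ψ x‖ * (δ / (1 + ∫ x, ‖ψ x‖)) := by
            refine norm_integral_le_of_norm_le
              ((ψ.continuous.integrable_of_hasCompactSupport ψ.hasCompactSupport).norm.mul_const _)
              (.of_forall fun x => ?_)
            rw [← mul_sub, norm_mul, ← RCLike.ofReal_sub, RCLike.norm_ofReal]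
            by_cases hx : x ∈ K
            · gcongr
              have := hg ⟨x, hx⟩
              rw [← Real.norm_eq_abs, norm_sub_rev]
              simpa [hΦ] using this.le
            · simp [image_eq_zero_of_notMem_tsupport hx]
      _ ≤ δ := by
            rw [integral_mul_const, mul_div_assoc', div_le_iff₀ (by positivity)]
            nlinarith
  have hae : ∀ᵐ x, ψ x = 0 := ae_eq_zero_of_integral_contDiff_smul_eq_zero
    (ψ.continuous.locallyIntegrable) fun g hg _ => by
      rw [← hcont g hg.continuous]
      exact integral_congr_ae (.of_forall fun x => 
        (RCLike.real_smul_eq_coe_mul _ _).trans (mul_comm _ _))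
  exact DFunLike.coe_injective ((ψ.continuous.ae_eq_iff_eq volume continuous_zero).1 hae)

/-- Density of the polynomials among distributions is used in dual form: the transpose of the
commutator takes only the value `0`. -/
theorem IsHadamard.commutesWithDilations {L : Dist 𝕜 d →L[𝕜] Dist 𝕜 d} (hL : IsHadamard L) :
    CommutesWithDilations L := by
  intro a
  obtain ⟨M, hM⟩ := exists_transpose (L ∘L dilation a - dilation a ∘L L)
  have hM₀ (φ : TestFun 𝕜 d) : M φ = 0 := eq_zero_of_forall_monomial fun α => by
    obtain ⟨m, hm⟩ := hL α
    rw [← hM, sub_apply, ContinuousLinearMap.comp_apply,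
      ContinuousLinearMap.comp_apply, hm, dilation_monomial, map_smul, map_smul, hm,
      dilation_monomial, smul_comm, sub_self]
    rfl
  rw [← sub_eq_zero]
  ext S φ
  rw [hM, hM₀, map_zero]
  rfl

end HadamardOperators

theorem theorem1p5 {𝕜 : Type*} [RCLike 𝕜] (d : ℕ)
    (L : HadamardOperators.Dist 𝕜 d →L[𝕜] HadamardOperators.Dist 𝕜 d) :
    (HadamardOperators.CommutesWithDilations L ↔
      ∃ T : HadamardOperators.DH 𝕜 d, HadamardOperators.IsStarConvBy L T) ∧
    (∀ T : HadamardOperators.DH 𝕜 d, HadamardOperators.IsStarConvBy L T →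
      (T : HadamardOperators.Dist 𝕜 d) = L (HadamardOperators.diracDelta 1)) ∧
    (HadamardOperators.IsHadamard L →
      HadamardOperators.CommutesWithDilations L ∧
      ∃ T : HadamardOperators.DH 𝕜 d, HadamardOperators.IsStarConvBy L T) :=
  ⟨⟨fun h => h.exists_isStarConvBy, fun ⟨_, h⟩ => h.commutesWithDilations⟩,
    fun _ h => h.eq_apply_diracDelta,
    fun h => ⟨h.commutesWithDilations, h.commutesWithDilations.exists_isStarConvBy⟩⟩
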